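/- Let $N\ge 1$, $T\ge 1$, and let $\Delta_N$ be the unit simplex in $\mathbb R^N$. Let $F$ be a probability law on $\mathbb R^N$ (the law of the preference shocks $\epsilon=(\epsilon_1,\dots,\epsilon_N)$) that has zero mean, is absolutely continuous with respect to Lebesgue measure and has full support. A function $G:\mathbb R_+^N\to\mathbb R_+$ is a *generator* if it is homogeneous of degree one; $G(y)\to\infty$ as $y_i\to\infty$, for every $i$; and, in the open orthant, $G$ is twice continuously differentiable and for distinct $i_1,\dots,i_k$ the mixed partial derivative $\partial^kG/\partial y_{i_1}\cdots\partial y_{i_k}$ exists and is $\ge 0$ for odd $k$ and $\le 0$ for even $k$. Assume that the shocks are multivariate extreme value with a generator $G$, centred by Euler's constant $\gamma$: if $\epsilon\sim F$ then $\epsilon+\gamma\mathbf 1$ has the distribution function $x\mapsto\exp\bigl(-G(e^{-x_1},\dots,e^{-x_N})\bigr)$. Assume moreover that for some $M>0$ $$\sum_{i=1}^N\frac{\partial^2G}{\partial y_i^2}(y)\,y_i^2\le M\,G(y)\qquad\text{for all }y\in(0,\infty)^N .$$ Let $u_1,\dots,u_T\in\mathbb R^N$ be any sequence of payoff vectors with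 $\|u_t\|_\infty\le u_{\max}$, and put $\theta_t=\sum_{s=1}^tu_s$, $\theta_0=0$. For $\eta>0$ let $\varphi(\theta)=\mathbb E_{\epsilon\sim F}\max_i(\theta_i+\eta\epsilon_i)$. The Social Surplus Algorithm (SSA) with parameter $\eta$ chooses $x_t=\nabla\varphi(\theta_{t-1})$ in period $t$, and its regret is $$R^T_{SSA}=\max_{x\in\Delta_N}\langle\theta_T,x\rangle-\sum_{t=1}^T\langle u_t,x_t\rangle .$$ Then, for every $\eta>0$, the function $\varphi$ is differentiable, the choices $x_t$ lie in $\Delta_N$, and $$R^T_{SSA}\le\eta\log G(\mathbf 1)+\frac{L}{2\eta}\,T\,u_{\max}^2,\qquad L=2M+1 .$$ Furthermore, if $N\ge2$ and $u_{\max}>0$, then $\eta=\sqrt{\dfrac{L\,T\,u_{\max}^2}{2\log G(\mathbf 1)}}$ is well defined and positive, and with this choice $$R^T_{SSA}\le u_{\max}\sqrt{2\log G(\mathbf 1)\,(2M+1)\,T}.$$ -/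

import Mathlib

open MeasureTheory Filter

noncomputable section

/-- The cumulative payoff vector `θ_t = u_1 + ⋯ + u_t` (so `θ_0 = 0`). -/
def cumPayoff {N : ℕ} (u : ℕ → Fin N → ℝ) (t : ℕ) : Fin N → ℝ :=
  ∑ s ∈ Finset.Icc 1 t, u s

/-- The regret after `T` periods of the choices `x_1, …, x_T` against the payoffs `u_1, …, u_T`:
`max_{x ∈ Δ_N} ⟨θ_T, x⟩ - ∑_{t=1}^T ⟨u_t, x_t⟩`. -/
def regret {N : ℕ} (u x : ℕ → Fin N → ℝ) (T : ℕ) : ℝ :=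
  sSup ((fun z => cumPayoff u T ⬝ᵥ z) '' stdSimplex ℝ (Fin N))
    - ∑ t ∈ Finset.Icc 1 T, u t ⬝ᵥ x t

/-- The standing assumption on the law `F` of the preference shocks: a probability measure on
`ℝ^N` with zero mean, absolutely continuous with respect to Lebesgue measure, with full support.
(The law depends neither on the period nor on past payoffs.) -/
structure ShockAssumption {N : ℕ} (F : Measure (Fin N → ℝ)) : Prop where
  isProbabilityMeasure : IsProbabilityMeasure F
  integrable : ∀ i, Integrable (fun ε : Fin N → ℝ => ε i) F
  mean_zero : ∀ i, ∫ ε, ε i ∂F = 0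
  absolutelyContinuous : F ≪ volume
  fullSupport : F.IsOpenPosMeasure

/-- The social surplus function `φ(θ) = E_ε (max_i (θ_i + η ε_i))`, `ε ∼ F`. -/
def socialSurplus {N : ℕ} (F : Measure (Fin N → ℝ)) (η : ℝ) (θ : Fin N → ℝ) : ℝ :=
  ∫ ε, ⨆ i, (θ i + η * ε i) ∂F

/-- The Social Surplus Algorithm with input `η`, `F`: the choice `x_t = ∇φ(θ_{t-1})` made in
period `t ≥ 1`, as the vector of the partial derivatives of `φ`. -/
def ssaChoice {N : ℕ} (F : Measure (Fin N → ℝ)) (η : ℝ) (u : ℕ → Fin N → ℝ) (t : ℕ) :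
    Fin N → ℝ :=
  fun i => fderiv ℝ (socialSurplus F η) (cumPayoff u (t - 1)) (Pi.single i 1)

/-- The partial derivative `∂f/∂y_i`. -/
def partialDeriv {N : ℕ} (i : Fin N) (f : (Fin N → ℝ) → ℝ) (y : Fin N → ℝ) : ℝ :=
  lineDeriv ℝ f y (Pi.single i 1)

/-- The iterated partial derivative of `f` along a list of coordinates. -/
def iterPartialDeriv {N : ℕ} (f : (Fin N → ℝ) → ℝ) : List (Fin N) → (Fin N → ℝ) → ℝ
  | [] => f
  | i :: l => partialDeriv i (iterPartialDeriv f l)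

/-- The open positive orthant of `ℝ^N`. -/
def posOrthant (N : ℕ) : Set (Fin N → ℝ) := {y | ∀ i, 0 < y i}

/-- A (McFadden) generator. `G` is a function on the closed orthant (its values elsewhere play no
role); derivatives are taken in the open orthant, where `G` is twice continuously differentiable
and all mixed partial derivatives in distinct coordinates exist. -/
structure IsGenerator {N : ℕ} (G : (Fin N → ℝ) → ℝ) : Prop where
  nonneg : ∀ y, 0 ≤ y → 0 ≤ G y
  homogeneous : ∀ y, 0 ≤ y → ∀ c : ℝ, 0 < c → G (c • y) = c * G y
  tendsto_atTop : ∀ i, ∀ y, 0 ≤ y →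
    Tendsto (fun s : ℝ => G (Function.update y i s)) atTop atTop
  contDiffOn : ContDiffOn ℝ 2 G (posOrthant N)
  mixed_exists : ∀ (i : Fin N) (l : List (Fin N)), (i :: l).Nodup → ∀ y ∈ posOrthant N,
    LineDifferentiableAt ℝ (iterPartialDeriv G l) y (Pi.single i 1)
  mixed_odd : ∀ l : List (Fin N), l.Nodup → Odd l.length → ∀ y ∈ posOrthant N,
    0 ≤ iterPartialDeriv G l y
  mixed_even : ∀ l : List (Fin N), l.Nodup → l ≠ [] → Even l.length → ∀ y ∈ posOrthant N,
    iterPartialDeriv G l y ≤ 0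

/-- `μ` is the multivariate extreme value law with generator `G`: its distribution function is
`x ↦ exp (-G (e^{-x_1}, …, e^{-x_N}))`. -/
def IsMEV {N : ℕ} (μ : Measure (Fin N → ℝ)) (G : (Fin N → ℝ) → ℝ) : Prop :=
  ∀ x : Fin N → ℝ, μ.real {ε | ∀ i, ε i ≤ x i} = Real.exp (-G (fun i => Real.exp (-x i)))

/-- The inequality `∑_i ∂²G/∂y_i² · y_i² ≤ M · G` on the open orthant, i.e. at all
`y = (e^{θ_1/η}, …, e^{θ_N/η})`. -/
def SecondOrderBound {N : ℕ} (G : (Fin N → ℝ) → ℝ) (M : ℝ) : Prop :=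
  ∀ y ∈ posOrthant N, ∑ i, partialDeriv i (partialDeriv i G) y * y i ^ 2 ≤ M * G y

end

/-! By homogeneity of G, the maximum of θ_i/η + ε_i + γ has distribution function exp(-G(e^{θ/η})
e^{-t}), a Gumbel law with mean log G(e^{θ/η}) + γ. The centring cancels γ, so φ(θ) = η log
G(e^{θ/η}) (`socialSurplus_eq_log`), which is smooth.

The regret bound is then a potential argument (`regret_le_of_potential`): φ dominates every θ_i
because the shocks have zero mean, and a descent inequality (`logGenerator_add_le`) telescopes to
bound φ(θ_T) by φ(0) = η log G(1), plus the gains of the algorithm, plus a quadratic error per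
period.

The constant 2M + 1 has two sources. The matrix y_i y_j ∂²G/∂y_i∂y_j has nonpositive off-diagonal
entries and, by Euler, zero column sums, so its quadratic form is controlled by twice its trace:
this gives 2M. The curvature of the exponential adds 1. The curvature of the logarithm has the
favourable sign and is dropped. -/

/-! ### The mean of a Gumbel law. -/

/-- The Gumbel integral `∫ log t · e^{-t} dt = -γ`. -/
theorem integral_log_mul_exp_neg :
    ∫ t in Set.Ioi (0 : ℝ), Real.log t * Real.exp (-t) = -Real.eulerMascheroniConstant := by
  have h1 := Complex.hasDerivAt_GammaIntegral (s := 1) (by simp)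
  have h2 : HasDerivAt Complex.GammaIntegral (-Real.eulerMascheroniConstant : ℂ) 1 := by
    refine Complex.hasDerivAt_Gamma_one.congr_of_eventuallyEq ?_
    have : {s : ℂ | 0 < s.re} ∈ nhds (1 : ℂ) :=
      (isOpen_lt continuous_const Complex.continuous_re).mem_nhds (by simp)
    filter_upwards [this] with s hs
    exact (Complex.Gamma_eq_integral hs).symm
  have h3 := h1.unique h2
  simp only [sub_self, Complex.cpow_zero, one_mul] at h3
  have h4 := integral_ofReal (𝕜 := ℂ) (f := fun t : ℝ => Real.log t * Real.exp (-t))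
    (μ := volume.restrict (Set.Ioi 0))
  simp only [Complex.coe_algebraMap, RCLike.ofReal_mul] at h4
  exact_mod_cast h4.symm.trans h3

theorem integral_log_expMeasure :
    ∫ z, Real.log z ∂(ProbabilityTheory.expMeasure 1) = -Real.eulerMascheroniConstant := by
  have hm : Measurable (ProbabilityTheory.gammaPDF 1 1) :=
    (ProbabilityTheory.measurable_gammaPDFReal 1 1).ennreal_ofReal
  rw [ProbabilityTheory.expMeasure, ProbabilityTheory.gammaMeasure,
    integral_withDensity_eq_integral_toReal_smul hm (by simp [ProbabilityTheory.gammaPDF]),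
    ← integral_log_mul_exp_neg, ← integral_indicator measurableSet_Ioi]
  congr 1
  ext z
  rcases le_or_gt z 0 with hz | hz
  · rw [Set.indicator_of_notMem (by simpa using hz)]
    rcases hz.lt_or_eq with hz | rfl
    · simp [ProbabilityTheory.gammaPDF_of_neg hz]
    · simp
  · rw [Set.indicator_of_mem (by simpa using hz), ProbabilityTheory.gammaPDF_of_nonneg hz.le,
      ENNReal.toReal_ofReal (by simp; positivity)]
    simp [mul_comm]

/-- The mean of a Gumbel law with location parameter `log c`. -/
theorem integral_id_of_gumbel (ν : Measure ℝ) [IsProbabilityMeasure ν] (c : ℝ) (hc : 0 < c)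
    (hν : ∀ t, ν.real (Set.Iic t) = Real.exp (-(c * Real.exp (-t)))) :
    ∫ x, x ∂ν = Real.log c + Real.eulerMascheroniConstant := by
  set E := ProbabilityTheory.expMeasure 1 with hE
  have : IsProbabilityMeasure E := ProbabilityTheory.isProbabilityMeasure_expMeasure one_pos
  have : NullSingletonClass E := by
    rw [hE, ProbabilityTheory.expMeasure, ProbabilityTheory.gammaMeasure]
    infer_instance
  have hmeas : Measurable fun z : ℝ => Real.log c - Real.log z :=
    measurable_const.sub Real.measurable_log
  have hIio (x : ℝ) (hx : 0 ≤ x) : E.real (Set.Iio x) = 1 - Real.exp (-x) := by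
    rw [measureReal_congr Iio_ae_eq_Iic, ← ProbabilityTheory.cdf_eq_real,
      ProbabilityTheory.cdf_expMeasure_eq one_pos, if_pos hx, one_mul]
  have hpos : ∀ᵐ z ∂E, 0 < z := by
    have : E.real (Set.Iic 0) = 0 := by
      rw [← ProbabilityTheory.cdf_eq_real, ProbabilityTheory.cdf_expMeasure_eq one_pos]; simp
    rw [measureReal_eq_zero_iff] at this
    filter_upwards [compl_mem_ae_iff.2 this] with z hz using by simpa using hz
  -- A Gumbel variable is log c - log Z with Z standard exponential.
  have hmap : ν = E.map fun z => Real.log c - Real.log z := by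
    have := Measure.isProbabilityMeasure_map (μ := E) hmeas.aemeasurable
    refine Measure.ext_of_Iic _ _ fun t => ?_
    rw [← measureReal_eq_measureReal_iff, hν, map_measureReal_apply hmeas measurableSet_Iic]
    have : ((fun z => Real.log c - Real.log z) ⁻¹' Set.Iic t : Set ℝ) =ᵐ[E]
        ((Set.Iio (c * Real.exp (-t)))ᶜ : Set ℝ) := by
      refine Filter.eventuallyEq_set.2 ?_
      filter_upwards [hpos] with z hz
      simp only [Set.mem_preimage, Set.mem_Iic, Set.mem_compl_iff, Set.mem_Iio, not_lt]
      rw [← Real.log_le_log_iff (by positivity) hz, Real.log_mul hc.ne' (Real.exp_ne_zero _),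
        Real.log_exp]
      constructor <;> intro h <;> linarith
    rw [measureReal_congr this, probReal_compl_eq_one_sub measurableSet_Iio,
      hIio _ (by positivity)]
    ring
  -- A non-integrable function has integral 0 by convention, whereas this integral is -γ ≠ 0.
  have hint : Integrable Real.log E := by
    by_contra h
    have := integral_log_expMeasure
    rw [integral_undef h] at this
    linarith [Real.one_half_lt_eulerMascheroniConstant]
  rw [hmap, integral_map hmeas.aemeasurable (by fun_prop),
    integral_sub (integrable_const _) hint, integral_log_expMeasure]
  simp

/-! ### The social surplus in closed form. -/

section Max

variable {N : ℕ}

theorem measurable_iSup_add_mul (θ : Fin N → ℝ) (η : ℝ) :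
    Measurable fun ε : Fin N → ℝ => ⨆ i, (θ i + η * ε i) :=
  Measurable.iSup fun i => by fun_prop

theorem iSup_le_iff_of_one_le (hN : 1 ≤ N) (f : Fin N → ℝ) (t : ℝ) :
    ⨆ i, f i ≤ t ↔ ∀ i, f i ≤ t := by
  have : Nonempty (Fin N) := ⟨⟨0, hN⟩⟩
  exact ciSup_le_iff (Set.finite_range f).bddAbove

theorem integrable_iSup_add_mul {F : Measure (Fin N → ℝ)}
    (hF : ShockAssumption F) (θ : Fin N → ℝ) (η : ℝ) :
    Integrable (fun ε : Fin N → ℝ => ⨆ i, (θ i + η * ε i)) F := by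
  have := hF.isProbabilityMeasure
  have hg : Integrable (fun ε : Fin N → ℝ => ∑ i, |θ i + η * ε i|) F :=
    integrable_finsetSum _ fun i _ => ((integrable_const _).add ((hF.integrable i).const_mul _)).abs
  refine hg.mono' (measurable_iSup_add_mul θ η).aestronglyMeasurable (ae_of_all _ fun ε => ?_)
  rcases isEmpty_or_nonempty (Fin N) with h | h
  · simp
  · obtain ⟨j, hj⟩ := exists_eq_ciSup_of_finite (f := fun i => θ i + η * ε i)
    rw [← hj, Real.norm_eq_abs]
    exact Finset.single_le_sum (f := fun i => |θ i + η * ε i|) (fun i _ => abs_nonneg _)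
      (Finset.mem_univ j)

theorem le_socialSurplus {F : Measure (Fin N → ℝ)} (hF : ShockAssumption F)
    (η : ℝ) (θ : Fin N → ℝ) (i : Fin N) : θ i ≤ socialSurplus F η θ := by
  have := hF.isProbabilityMeasure
  have hi : Integrable (fun ε : Fin N → ℝ => θ i + η * ε i) F :=
    (integrable_const _).add ((hF.integrable i).const_mul _)
  have : ∫ ε, (θ i + η * ε i) ∂F = θ i := by
    rw [integral_add (integrable_const _) ((hF.integrable i).const_mul _), integral_const_mul,
      hF.mean_zero]
    simp
  calc θ i = ∫ ε, (θ i + η * ε i) ∂F := this.symm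
    _ ≤ _ := integral_mono hi (integrable_iSup_add_mul hF θ η) fun ε =>
      le_ciSup (f := fun i => θ i + η * ε i) (Set.finite_range _).bddAbove i

/-- With two or more alternatives the social surplus at zero payoffs is positive. -/
theorem socialSurplus_zero_pos {F : Measure (Fin N → ℝ)} (hF : ShockAssumption F)
    (hN : 2 ≤ N) {η : ℝ} (hη : 0 < η) : 0 < socialSurplus F η 0 := by
  have := hF.isProbabilityMeasure
  have := hF.fullSupport
  let i : Fin N := ⟨0, by omega⟩
  let j : Fin N := ⟨1, by omega⟩
  have hij : j ≠ i := by simp [i, j]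
  refine (le_socialSurplus hF η 0 i).lt_of_ne fun h => ?_
  have hle (k : Fin N) (ε : Fin N → ℝ) : η * ε k ≤ ⨆ i, ((0 : Fin N → ℝ) i + η * ε i) := by
    simpa using le_ciSup (f := fun i => (0 : Fin N → ℝ) i + η * ε i) (Set.finite_range _).bddAbove k
  have hint := integrable_iSup_add_mul hF 0 η
  have hi := (hF.integrable i).const_mul η
  have h0 : ∫ ε, ((⨆ i, ((0 : Fin N → ℝ) i + η * ε i)) - η * ε i) ∂F = 0 := by
    rw [integral_sub hint hi, integral_const_mul, hF.mean_zero, mul_zero, sub_zero]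
    simpa [socialSurplus] using h.symm
  rw [integral_eq_zero_iff_of_nonneg (fun ε => sub_nonneg.2 (hle i ε)) (hint.sub hi)] at h0
  -- Equality would force the maximum to be η ε_i almost surely, but full support gives ε_j > ε_i
  -- positive probability.
  have hopen : IsOpen {ε : Fin N → ℝ | ε i < ε j} :=
    isOpen_lt (continuous_apply i) (continuous_apply j)
  refine hopen.measure_ne_zero F ⟨Pi.single j 1, by simp [hij.symm]⟩ ?_
  refine measure_mono_null (fun ε hε => ?_) (ae_iff.1 h0)
  simp only [Set.mem_ofPred_eq] at hε
  exact (sub_pos.2 ((mul_lt_mul_of_pos_left hε hη).trans_le (hle j ε))).ne'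

variable {F : Measure (Fin N → ℝ)} {G : (Fin N → ℝ) → ℝ}

/-- The thresholds t - a_i enter G as e^{-t} e^{a_i}, and homogeneity takes the factor e^{-t}
outside. -/
theorem measureReal_forall_add_le (hG : IsGenerator G)
    (hMEV : IsMEV (F.map fun ε i => ε i + Real.eulerMascheroniConstant) G) (a : Fin N → ℝ) (t : ℝ) :
    F.real {ε | ∀ i, a i + ε i + Real.eulerMascheroniConstant ≤ t} =
      Real.exp (-(G (fun i => Real.exp (a i)) * Real.exp (-t))) := by
  have h := hMEV fun i => t - a i
  rw [map_measureReal_apply (by fun_prop)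
    (by simpa only [Set.ofPred_forall] using
      MeasurableSet.iInter fun i => measurableSet_le (measurable_pi_apply i) measurable_const)] at h
  have hG' : G (fun i => Real.exp (-(t - a i))) =
      G (fun i => Real.exp (a i)) * Real.exp (-t) := by
    rw [mul_comm, ← hG.homogeneous _ (fun i => (Real.exp_pos _).le) _ (Real.exp_pos _)]
    congr 1
    ext i
    simp [← Real.exp_add, sub_eq_add_neg, add_comm]
  rw [← hG', ← h]
  congr 1
  ext ε
  simp only [Set.mem_ofPred_eq, Set.mem_preimage]
  exact forall_congr' fun i => by constructor <;> intro h <;> linarith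

/-- If G(y) = 0, the distribution function of the maximum shifted by log y is identically 1, so one
real coordinate would lie almost surely below every -n. -/
theorem generator_pos [IsProbabilityMeasure F] (hN : 1 ≤ N) (hG : IsGenerator G)
    (hMEV : IsMEV (F.map fun ε i => ε i + Real.eulerMascheroniConstant) G) {y : Fin N → ℝ}
    (hy : y ∈ posOrthant N) : 0 < G y := by
  refine (hG.nonneg y fun i => (hy i).le).lt_of_ne fun h => ?_
  set i : Fin N := ⟨0, hN⟩
  have h1 (t : ℝ) : F.real {ε | ∀ i, Real.log (y i) + ε i + Real.eulerMascheroniConstant ≤ t} = 1 := by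
    rw [measureReal_forall_add_le hG hMEV]
    simp [Real.exp_log (hy _), ← h]
  have h2 (n : ℕ) : ∀ᵐ ε ∂F, Real.log (y i) + ε i + Real.eulerMascheroniConstant ≤ -n := by
    have hm : MeasurableSet
        {ε : Fin N → ℝ | ∀ i, Real.log (y i) + ε i + Real.eulerMascheroniConstant ≤ -n} := by
      simpa only [Set.ofPred_forall] using MeasurableSet.iInter fun i =>
        measurableSet_le (by fun_prop) measurable_const
    filter_upwards [(mem_ae_iff_prob_eq_one hm).2 ((ENNReal.toReal_eq_one_iff _).1 (h1 (-n)))]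
      with ε hε using hε i
  obtain ⟨ε, hε⟩ := (ae_all_iff.2 h2).exists
  obtain ⟨n, hn⟩ := exists_nat_gt (-(Real.log (y i) + ε i + Real.eulerMascheroniConstant))
  linarith [hε n]

/-- Under the extreme value law with generator `G`, the social surplus is
`η log G(e^{θ_1/η}, …, e^{θ_N/η})`. -/
theorem socialSurplus_eq_log (hF : ShockAssumption F) (hN : 1 ≤ N) (hG : IsGenerator G)
    (hMEV : IsMEV (F.map fun ε i => ε i + Real.eulerMascheroniConstant) G) {η : ℝ} (hη : 0 < η)
    (θ : Fin N → ℝ) :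
    socialSurplus F η θ = η * Real.log (G fun i => Real.exp (θ i / η)) := by
  have := hF.isProbabilityMeasure
  set X : (Fin N → ℝ) → ℝ := fun ε => ⨆ i, (θ i + η * ε i)
  have hX : Measurable X := measurable_iSup_add_mul θ η
  set Y : (Fin N → ℝ) → ℝ := fun ε => X ε / η + Real.eulerMascheroniConstant
  have hY : Measurable Y := (hX.div_const _).add_const _
  have hXint : Integrable X F := integrable_iSup_add_mul hF θ η
  have := Measure.isProbabilityMeasure_map (μ := F) hY.aemeasurable
  have hmean := integral_id_of_gumbel (F.map Y) (G fun i => Real.exp (θ i / η))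
    (generator_pos hN hG hMEV fun i => Real.exp_pos _) fun t => by
      rw [map_measureReal_apply hY measurableSet_Iic,
        ← measureReal_forall_add_le hG hMEV (fun i => θ i / η) t]
      congr 1
      ext ε
      simp only [Set.mem_preimage, Set.mem_Iic, Set.mem_ofPred_eq, Y, X]
      rw [← le_sub_iff_add_le, div_le_iff₀ hη, iSup_le_iff_of_one_le hN]
      refine forall_congr' fun i => ?_
      rw [← div_le_iff₀ hη, le_sub_iff_add_le, add_div, mul_div_cancel_left₀ _ hη.ne']
  rw [integral_map hY.aemeasurable (by fun_prop)] at hmean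
  simp only [Y] at hmean
  rw [integral_add (hXint.div_const _) (integrable_const _), integral_div] at hmean
  simp only [integral_const, probReal_univ, one_smul, add_left_inj] at hmean
  rw [← hmean, mul_div_cancel₀ _ hη.ne']
  rfl

end Max

/-! ### Two auxiliary inequalities. -/

/-- A quadratic form whose matrix has vanishing column sums and nonpositive off-diagonal entries
is bounded on a cube by twice its trace. -/
theorem sum_mul_mul_le_two_mul_trace {ι : Type*} [Fintype ι] [DecidableEq ι] (a : ι → ι → ℝ)
    (hsum : ∀ j, ∑ i, a i j = 0) (hoff : ∀ i j, i ≠ j → a i j ≤ 0) (v : ι → ℝ) (B : ℝ)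
    (hv : ∀ i, |v i| ≤ B) :
    ∑ j, ∑ i, a i j * (v i * v j) ≤ 2 * B ^ 2 * ∑ i, a i i := by
  rw [Finset.mul_sum]
  refine Finset.sum_le_sum fun j _ => ?_
  have hvv (i : ι) : |v i * v j| ≤ B ^ 2 := by
    rw [abs_mul, sq]
    exact mul_le_mul (hv i) (hv j) (abs_nonneg _) ((abs_nonneg _).trans (hv i))
  have hdiag : 0 ≤ a j j := by
    have h := hsum j
    rw [← Finset.add_sum_erase _ _ (Finset.mem_univ j)] at h
    have := Finset.sum_nonpos fun i (hi : i ∈ Finset.univ.erase j) =>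
      hoff i j (Finset.ne_of_mem_erase hi)
    linarith
  -- Off the diagonal, a_ij ≤ 0 makes -B² a_ij an upper bound. On it, B² a_jj = -B² a_jj + 2B² a_jj.
  -- The terms -B² a_ij then sum to zero over the column.
  have h1 (i : ι) : a i j * (v i * v j) ≤
      -(B ^ 2 * a i j) + if i = j then 2 * B ^ 2 * a j j else 0 := by
    have h2 := abs_le.1 (hvv i)
    split_ifs with h
    · subst h
      nlinarith
    · nlinarith [hoff i j h]
  calc _ ≤ _ := Finset.sum_le_sum fun i _ => h1 i
    _ = _ := by simp [Finset.sum_add_distrib, ← Finset.mul_sum, hsum]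

/-- A second-order upper bound for a function with second derivative at most `C`. -/
theorem le_add_deriv_add_of_deriv2_le {f f' f'' : ℝ → ℝ} {C : ℝ} (hf : ∀ s, HasDerivAt f (f' s) s)
    (hf' : ∀ s, HasDerivAt f' (f'' s) s) (hC : ∀ s, f'' s ≤ C) :
    f 1 ≤ f 0 + f' 0 + C / 2 := by
  have h1 (s : ℝ) (hs : 0 ≤ s) : f' s ≤ f' 0 + C * s := by
    have hd (x : ℝ) : HasDerivAt (fun x => f' x - C * x) (f'' x - C * 1) x :=
      (hf' x).sub ((hasDerivAt_id x).const_mul C)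
    have := antitone_of_deriv_nonpos (fun x => (hd x).differentiableAt)
      (fun x => by rw [(hd x).deriv]; linarith [hC x]) hs
    simp only [mul_zero, sub_zero] at this
    linarith
  have hd (x : ℝ) : HasDerivAt (fun x => f x - f' 0 * x - C / 2 * x ^ 2)
      (f' x - f' 0 * 1 - C / 2 * (2 * x)) x := by
    refine (((hf x).sub ((hasDerivAt_id x).const_mul (f' 0))).sub
      ((hasDerivAt_pow 2 x).const_mul (C / 2))).congr_deriv ?_
    simp
  have := antitoneOn_of_deriv_nonpos (convex_Icc (0 : ℝ) 1)
    (fun x _ => (hd x).continuousAt.continuousWithinAt)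
    (fun x _ => (hd x).differentiableAt.differentiableWithinAt)
    (fun x hx => by
      rw [interior_Icc] at hx
      rw [(hd x).deriv]
      linarith [h1 x hx.1.le])
    (Set.left_mem_Icc.2 zero_le_one) (Set.right_mem_Icc.2 zero_le_one) zero_le_one
  simp only at this
  linarith

/-! ### Euler identities and curvature bounds for the generator. -/

section Generator

variable {N : ℕ} {G : (Fin N → ℝ) → ℝ}

theorem isOpen_posOrthant : IsOpen (posOrthant N) := by
  simp only [posOrthant, Set.ofPred_forall]
  exact isOpen_iInter_of_finite fun i => isOpen_lt continuous_const (continuous_apply i)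

theorem ContinuousLinearMap.apply_mul_eq_sum {E : Type*} [AddCommGroup E] [Module ℝ E]
    [TopologicalSpace E] (A : (Fin N → ℝ) →L[ℝ] E) (w y : Fin N → ℝ) :
    A (w * y) = ∑ i, (w i * y i) • A (Pi.single i 1) := by
  conv_lhs => rw [pi_eq_sum_univ' (w * y)]
  simp [map_sum]

namespace IsGenerator

variable (hG : IsGenerator G) {y : Fin N → ℝ} (hy : y ∈ posOrthant N)
include hG hy

theorem contDiffAt : ContDiffAt ℝ 2 G y :=
  hG.contDiffOn.contDiffAt (isOpen_posOrthant.mem_nhds hy)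

theorem differentiableAt : DifferentiableAt ℝ G y :=
  (hG.contDiffAt hy).differentiableAt (by norm_num)

theorem differentiableAt_fderiv : DifferentiableAt ℝ (fderiv ℝ G) y :=
  ((hG.contDiffAt hy).fderiv_right (m := 1) (by norm_num)).differentiableAt (by norm_num)

theorem partialDeriv_eq (i : Fin N) : partialDeriv i G y = fderiv ℝ G y (Pi.single i 1) :=
  (hG.differentiableAt hy).lineDeriv_eq_fderiv

theorem partialDeriv_partialDeriv_eq (i j : Fin N) : partialDeriv i (partialDeriv j G) y =
    fderiv ℝ (fderiv ℝ G) y (Pi.single i 1) (Pi.single j 1) := by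
  have h : partialDeriv j G =ᶠ[nhds y] fun z => fderiv ℝ G z (Pi.single j 1) := by
    filter_upwards [isOpen_posOrthant.mem_nhds hy] with z hz using hG.partialDeriv_eq hz j
  have h2 := (hG.differentiableAt_fderiv hy).hasFDerivAt.clm_apply
    (hasFDerivAt_const (Pi.single j (1 : ℝ)) y)
  rw [partialDeriv, h.lineDeriv_eq, h2.differentiableAt.lineDeriv_eq_fderiv, h2.fderiv]
  simp

theorem fderiv_nonneg (i : Fin N) : 0 ≤ fderiv ℝ G y (Pi.single i 1) := by
  rw [← hG.partialDeriv_eq hy]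
  exact hG.mixed_odd [i] (by simp) (by simp) y hy

theorem fderiv_fderiv_nonpos {i j : Fin N} (hij : i ≠ j) :
    fderiv ℝ (fderiv ℝ G) y (Pi.single i 1) (Pi.single j 1) ≤ 0 := by
  rw [← hG.partialDeriv_partialDeriv_eq hy]
  exact hG.mixed_even [i, j] (by simpa using hij) (by simp) ⟨1, rfl⟩ y hy

/-- Euler's identity for the homogeneous function `G`. -/
theorem fderiv_self : fderiv ℝ G y y = G y := by
  have h1 : HasDerivAt (fun c : ℝ => G (c • y)) (fderiv ℝ G y y) 1 := by
    have h := (hasDerivAt_id (1 : ℝ)).smul_const y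
    simp only [one_smul] at h
    have hd := (hG.differentiableAt hy).hasFDerivAt
    -- The base point is written as 1 • y so that the chain rule applies to c ↦ c • y at c = 1.
    rw [← one_smul ℝ y] at hd
    exact (hd.comp_hasDerivAt (1 : ℝ) h).congr_deriv (by simp)
  have h2 : HasDerivAt (fun c : ℝ => c * G y) (G y) 1 := by
    simpa using (hasDerivAt_id (1 : ℝ)).mul_const (G y)
  refine h1.unique (h2.congr_of_eventuallyEq ?_)
  filter_upwards [lt_mem_nhds one_pos] with c hc using hG.homogeneous y (fun i => (hy i).le) c hc

theorem fderiv_smul {c : ℝ} (hc : 0 < c) : fderiv ℝ G (c • y) = fderiv ℝ G y := by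
  have hcy : c • y ∈ posOrthant N := fun i => mul_pos hc (hy i)
  have h1 : HasFDerivAt (fun z => G (c • z)) (c • fderiv ℝ G (c • y)) y := by
    have h := (hG.differentiableAt hcy).hasFDerivAt.comp y ((hasFDerivAt_id y).const_smul c)
    refine h.congr_fderiv ?_
    ext v
    simp
  have h2 : HasFDerivAt (fun z => c * G z) (c • fderiv ℝ G y) y :=
    (hG.differentiableAt hy).hasFDerivAt.const_mul c
  refine smul_right_injective _ hc.ne' (h1.unique (h2.congr_of_eventuallyEq ?_))
  filter_upwards [isOpen_posOrthant.mem_nhds hy] with z hz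
    using hG.homogeneous z (fun i => (hz i).le) c hc

/-- The gradient of `G` is homogeneous of degree zero. -/
theorem fderiv_fderiv_self : fderiv ℝ (fderiv ℝ G) y y = 0 := by
  have h1 : HasDerivAt (fun c : ℝ => fderiv ℝ G (c • y)) (fderiv ℝ (fderiv ℝ G) y y) 1 := by
    have h := (hasDerivAt_id (1 : ℝ)).smul_const y
    simp only [one_smul] at h
    have hd := (hG.differentiableAt_fderiv hy).hasFDerivAt
    rw [← one_smul ℝ y] at hd
    exact (hd.comp_hasDerivAt (1 : ℝ) h).congr_deriv (by simp)
  refine h1.unique ((hasDerivAt_const (1 : ℝ) (fderiv ℝ G y)).congr_of_eventuallyEq ?_)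
  filter_upwards [lt_mem_nhds one_pos] with c hc using hG.fderiv_smul hy hc

/-- Since the partial derivatives are nonnegative, w_i² can be replaced by B²; Euler's identity
evaluates the rest. -/
theorem fderiv_sq_mul_le {w : Fin N → ℝ} {B : ℝ} (hw : ∀ i, |w i| ≤ B) :
    fderiv ℝ G y (w * (w * y)) ≤ B ^ 2 * G y := by
  rw [← mul_assoc, ContinuousLinearMap.apply_mul_eq_sum, ← hG.fderiv_self hy]
  conv_rhs => rw [← one_mul y, ContinuousLinearMap.apply_mul_eq_sum, one_mul, Finset.mul_sum]
  refine Finset.sum_le_sum fun i _ => ?_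
  have h1 : w i * w i ≤ B ^ 2 := by
    rw [← sq]
    exact sq_le_sq' (abs_le.1 (hw i)).1 (abs_le.1 (hw i)).2
  have h2 := mul_nonneg (hy i).le (hG.fderiv_nonneg hy i)
  simp only [Pi.mul_apply, Pi.one_apply, smul_eq_mul]
  nlinarith

/-- The trace inequality applies to the Hessian scaled by y_i y_j: homogeneity of degree zero of the
gradient kills the column sums, and the sign of the mixed derivatives handles the off-diagonal. -/
theorem fderiv_fderiv_mul_le {M : ℝ} (hGM : SecondOrderBound G M) {w : Fin N → ℝ} {B : ℝ}
    (hw : ∀ i, |w i| ≤ B) :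
    fderiv ℝ (fderiv ℝ G) y (w * y) (w * y) ≤ 2 * M * B ^ 2 * G y := by
  set H : Fin N → Fin N → ℝ := fun i j =>
    fderiv ℝ (fderiv ℝ G) y (Pi.single i 1) (Pi.single j 1)
  have hcol (j : Fin N) : ∑ i, y i * H i j = 0 := by
    have h := congrArg (fun A => A (Pi.single j (1 : ℝ))) (hG.fderiv_fderiv_self hy)
    rw [← one_mul y, ContinuousLinearMap.apply_mul_eq_sum, one_mul] at h
    simpa [sum_apply] using h
  have h1 := sum_mul_mul_le_two_mul_trace (fun i j => y i * y j * H i j)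
    (fun j => by
      rw [← mul_zero (y j), ← hcol j, Finset.mul_sum]
      exact Finset.sum_congr rfl fun i _ => by ring)
    (fun i j hij => mul_nonpos_of_nonneg_of_nonpos (mul_pos (hy i) (hy j)).le
      (hG.fderiv_fderiv_nonpos hy hij)) w B hw
  have h2 := hGM y hy
  simp only [hG.partialDeriv_partialDeriv_eq hy] at h2
  calc fderiv ℝ (fderiv ℝ G) y (w * y) (w * y)
      = ∑ j, ∑ i, y i * y j * H i j * (w i * w j) := by
        rw [ContinuousLinearMap.apply_mul_eq_sum (fderiv ℝ (fderiv ℝ G) y (w * y))]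
        refine Finset.sum_congr rfl fun j _ => ?_
        rw [ContinuousLinearMap.apply_mul_eq_sum, sum_apply, Finset.smul_sum]
        refine Finset.sum_congr rfl fun i _ => ?_
        simp only [smul_apply, smul_eq_mul, H]
        ring
    _ ≤ _ := h1
    _ = 2 * B ^ 2 * ∑ i, H i i * y i ^ 2 := by
        congr 1
        exact Finset.sum_congr rfl fun i _ => by ring
    _ ≤ 2 * B ^ 2 * (M * G y) := by gcongr
    _ = _ := by ring

end IsGenerator

/-! ### Gradient and smoothness of the potential. -/

/-- The potential `θ ↦ η log G(e^{θ_1/η}, …, e^{θ_N/η})`. -/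
noncomputable def logGenerator {N : ℕ} (G : (Fin N → ℝ) → ℝ) (η : ℝ) (θ : Fin N → ℝ) : ℝ :=
  η * Real.log (G fun i => Real.exp (θ i / η))

theorem exp_mem_posOrthant (x : Fin N → ℝ) : (fun i => Real.exp (x i)) ∈ posOrthant N :=
  fun i => Real.exp_pos (x i)

variable (hG : IsGenerator G) (hpos : ∀ y ∈ posOrthant N, 0 < G y) {η : ℝ} (hη : 0 < η)
include hG hpos

theorem differentiable_logGenerator : Differentiable ℝ (logGenerator G η) := by
  intro θ
  have h1 : DifferentiableAt ℝ (fun θ : Fin N → ℝ => fun i => Real.exp (θ i / η)) θ := by fun_prop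
  have h2 := (hG.differentiableAt (exp_mem_posOrthant fun i => θ i / η)).comp θ h1
  exact (h2.log (hpos _ (exp_mem_posOrthant _)).ne').const_mul η

omit hG hpos in
theorem hasDerivAt_exp_line (θ u : Fin N → ℝ) (η s : ℝ) :
    HasDerivAt (fun s : ℝ => fun i => Real.exp ((θ i + s * u i) / η))
      ((η⁻¹ • u) * fun i => Real.exp ((θ i + s * u i) / η)) s := by
  refine hasDerivAt_pi.2 fun i => ?_
  have h := ((((hasDerivAt_id s).mul_const (u i)).const_add (θ i)).div_const η).exp
  refine h.congr_deriv ?_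
  simp [div_eq_inv_mul, mul_comm]

theorem hasDerivAt_logGenerator_line (θ u : Fin N → ℝ) (s : ℝ) :
    HasDerivAt (fun s : ℝ => logGenerator G η (θ + s • u))
      (η * (fderiv ℝ G (fun i => Real.exp ((θ i + s * u i) / η))
        ((η⁻¹ • u) * fun i => Real.exp ((θ i + s * u i) / η)) /
          G fun i => Real.exp ((θ i + s * u i) / η))) s := by
  have hy := exp_mem_posOrthant fun i => (θ i + s * u i) / η
  have h := (hG.differentiableAt hy).hasFDerivAt.comp_hasDerivAt s (hasDerivAt_exp_line θ u η s)
  exact (h.log (hpos _ hy).ne').const_mul η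

include hη

theorem fderiv_logGenerator (θ u : Fin N → ℝ) :
    fderiv ℝ (logGenerator G η) θ u =
      fderiv ℝ G (fun i => Real.exp (θ i / η)) (u * fun i => Real.exp (θ i / η)) /
        G fun i => Real.exp (θ i / η) := by
  rw [← (differentiable_logGenerator hG hpos θ).lineDeriv_eq_fderiv, lineDeriv,
    (hasDerivAt_logGenerator_line hG hpos θ u 0).deriv]
  simp only [zero_mul, add_zero, smul_mul_assoc, map_smul, smul_eq_mul]
  field_simp

/-- The coordinates are y_i ∂_iG(y) / G(y): nonnegative by monotonicity, with sum 1 by Euler. -/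
theorem fderiv_logGenerator_mem_stdSimplex (θ : Fin N → ℝ) :
    (fun i => fderiv ℝ (logGenerator G η) θ (Pi.single i 1)) ∈ stdSimplex ℝ (Fin N) := by
  set y : Fin N → ℝ := fun i => Real.exp (θ i / η) with hy_def
  have hy : y ∈ posOrthant N := exp_mem_posOrthant fun i => θ i / η
  refine ⟨fun i => ?_, ?_⟩
  · simp only [fderiv_logGenerator hG hpos hη]
    refine div_nonneg ?_ (hpos y hy).le
    have : (Pi.single i 1 : Fin N → ℝ) * y = y i • Pi.single i 1 := by
      ext j
      rcases eq_or_ne j i with rfl | h <;> simp [*]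
    rw [← hy_def, this, map_smul]
    exact mul_nonneg (hy i).le (hG.fderiv_nonneg hy i)
  · rw [← map_sum, show ∑ i, Pi.single i (1 : ℝ) = (1 : Fin N → ℝ) from
      Finset.univ_sum_single (1 : Fin N → ℝ)]
    rw [fderiv_logGenerator hG hpos hη, one_mul, ← hy_def, hG.fderiv_self hy,
      div_self (hpos y hy).ne']

/-- The gradient of the potential is Lipschitz with constant `(2M+1)/η`, in the form of the
descent inequality. -/
theorem logGenerator_add_le {M : ℝ} (hGM : SecondOrderBound G M) (θ u : Fin N → ℝ) :
    logGenerator G η (θ + u) ≤ logGenerator G η θ + fderiv ℝ (logGenerator G η) θ u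
      + (2 * M + 1) / (2 * η) * ‖u‖ ^ 2 := by
  set y : ℝ → Fin N → ℝ := fun s i => Real.exp ((θ i + s * u i) / η) with hy_def
  set w : Fin N → ℝ := η⁻¹ • u with hw_def
  have hy (s : ℝ) : y s ∈ posOrthant N := exp_mem_posOrthant fun i => (θ i + s * u i) / η
  have hyd (s : ℝ) : HasDerivAt y (w * y s) s := hasDerivAt_exp_line θ u η s
  have hw (i : Fin N) : |w i| ≤ ‖u‖ / η := by
    rw [hw_def, Pi.smul_apply, smul_eq_mul, abs_mul, abs_of_pos (inv_pos.2 hη), div_eq_inv_mul]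
    exact mul_le_mul_of_nonneg_left (norm_le_pi_norm u i) (inv_pos.2 hη).le
  have hg (s : ℝ) : HasDerivAt (fun s => G (y s)) (fderiv ℝ G (y s) (w * y s)) s :=
    (hG.differentiableAt (hy s)).hasFDerivAt.comp_hasDerivAt s (hyd s)
  have hg' (s : ℝ) : HasDerivAt (fun s => fderiv ℝ G (y s) (w * y s))
      (fderiv ℝ (fderiv ℝ G) (y s) (w * y s) (w * y s) + fderiv ℝ G (y s) (w * (w * y s))) s :=
    ((hG.differentiableAt_fderiv (hy s)).hasFDerivAt.comp_hasDerivAt s (hyd s)).clm_apply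
      ((hyd s).const_mul w)
  have key := le_add_deriv_add_of_deriv2_le (C := (2 * M + 1) / η * ‖u‖ ^ 2)
    (hasDerivAt_logGenerator_line hG hpos θ u)
    (fun s => ((hg' s).div (hg s) (hpos _ (hy s)).ne').const_mul η) (fun s => by
      have h0 := hpos _ (hy s)
      have h1 := hG.fderiv_fderiv_mul_le (hy s) hGM hw
      have h2 := hG.fderiv_sq_mul_le (hy s) hw
      rw [mul_div_assoc', div_le_iff₀ (by positivity)]
      have h3 : η * ((2 * M * (‖u‖ / η) ^ 2 * G (y s) + (‖u‖ / η) ^ 2 * G (y s)) * G (y s)) =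
          (2 * M + 1) / η * ‖u‖ ^ 2 * G (y s) ^ 2 := by
        field_simp
      rw [← h3]
      refine mul_le_mul_of_nonneg_left ?_ hη.le
      have h4 := mul_le_mul_of_nonneg_right (add_le_add h1 h2) h0.le
      -- This square is the negative term of the quotient rule, which is discarded.
      have h5 := mul_self_nonneg (fderiv ℝ G (y s) (w * y s))
      linarith)
  have h0 : fderiv ℝ (logGenerator G η) θ u = η * (fderiv ℝ G (y 0) (w * y 0) / G (y 0)) := by
    rw [fderiv_logGenerator hG hpos hη]
    simp only [hy_def, hw_def, zero_mul, add_zero, smul_mul_assoc, map_smul, smul_eq_mul]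
    field_simp
  simp only [one_smul, zero_smul, add_zero] at key
  rw [h0]
  refine key.trans (le_of_eq ?_)
  have : (2 * M + 1) / η * ‖u‖ ^ 2 / 2 = (2 * M + 1) / (2 * η) * ‖u‖ ^ 2 := by
    field_simp
  rw [this]

end Generator

/-! ### Regret of gradient choices. -/

theorem cumPayoff_succ {N : ℕ} (u : ℕ → Fin N → ℝ) (t : ℕ) :
    cumPayoff u (t + 1) = cumPayoff u t + u (t + 1) := by
  rw [cumPayoff, cumPayoff, Finset.sum_Icc_succ_top (by omega)]

/-- A potential function bounds the regret of the choices given by its gradient. -/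
theorem regret_le_of_potential {N : ℕ} (hN : 1 ≤ N) {ψ : (Fin N → ℝ) → ℝ} {K B : ℝ}
    (hK : 0 ≤ K) (hmax : ∀ θ i, θ i ≤ ψ θ)
    (hstep : ∀ θ u, ψ (θ + u) ≤ ψ θ + fderiv ℝ ψ θ u + K * ‖u‖ ^ 2)
    (u : ℕ → Fin N → ℝ) (T : ℕ) (hu : ∀ t ∈ Finset.Icc 1 T, ‖u t‖ ≤ B) :
    regret u (fun t i => fderiv ℝ ψ (cumPayoff u (t - 1)) (Pi.single i 1)) T
      ≤ ψ 0 + K * T * B ^ 2 := by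
  have hdot (θ v : Fin N → ℝ) :
      (v ⬝ᵥ fun i => fderiv ℝ ψ θ (Pi.single i 1)) = fderiv ℝ ψ θ v := by
    conv_rhs => rw [← mul_one v, ContinuousLinearMap.apply_mul_eq_sum]
    simp [dotProduct]
  have htel : ψ (cumPayoff u T) ≤ ψ 0 + ∑ t ∈ Finset.Icc 1 T,
      (u t ⬝ᵥ fun i => fderiv ℝ ψ (cumPayoff u (t - 1)) (Pi.single i 1)) + K * T * B ^ 2 := by
    induction T with
    | zero => simp [cumPayoff]
    | succ T ih =>
      have h1 := ih fun t ht => hu t (Finset.Icc_subset_Icc_right T.le_succ ht)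
      have h2 := hstep (cumPayoff u T) (u (T + 1))
      have h3 : K * ‖u (T + 1)‖ ^ 2 ≤ K * B ^ 2 := by
        gcongr
        exact hu _ (by simp)
      rw [Finset.sum_Icc_succ_top (by omega), cumPayoff_succ, hdot, Nat.add_sub_cancel]
      push_cast
      linarith
  have hsup : sSup ((fun z => cumPayoff u T ⬝ᵥ z) '' stdSimplex ℝ (Fin N)) ≤
      ψ (cumPayoff u T) := by
    refine csSup_le ⟨_, _, single_mem_stdSimplex ℝ (⟨0, hN⟩ : Fin N), rfl⟩ ?_
    rintro _ ⟨z, hz, rfl⟩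
    calc cumPayoff u T ⬝ᵥ z ≤ ∑ i, ψ (cumPayoff u T) * z i :=
          Finset.sum_le_sum fun i _ => mul_le_mul_of_nonneg_right (hmax _ i) (hz.1 i)
      _ = ψ (cumPayoff u T) := by rw [← Finset.mul_sum, hz.2, mul_one]
  rw [regret]
  linarith

theorem mainTheorem2 (N : ℕ) (hN : 1 ≤ N) (T : ℕ) (hT : 1 ≤ T)
    (F : Measure (Fin N → ℝ)) (hF : ShockAssumption F)
    (G : (Fin N → ℝ) → ℝ) (hG : IsGenerator G)
    (hMEV : IsMEV (F.map fun ε i => ε i + Real.eulerMascheroniConstant) G)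
    (M : ℝ) (hM : 0 < M) (hGM : SecondOrderBound G M)
    (umax : ℝ) (u : ℕ → Fin N → ℝ) (hu : ∀ t ∈ Finset.Icc 1 T, ‖u t‖ ≤ umax) :
    (∀ η : ℝ, 0 < η →
      Differentiable ℝ (socialSurplus F η) ∧
      (∀ t ∈ Finset.Icc 1 T, ssaChoice F η u t ∈ stdSimplex ℝ (Fin N)) ∧
      regret u (ssaChoice F η u) T
        ≤ η * Real.log (G 1) + (2 * M + 1) / (2 * η) * T * umax ^ 2) ∧
    (2 ≤ N → 0 < umax → ∀ η : ℝ,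
      η = √((2 * M + 1) * T * umax ^ 2 / (2 * Real.log (G 1))) →
      0 < η ∧
      regret u (ssaChoice F η u) T
        ≤ umax * √(2 * Real.log (G 1) * (2 * M + 1) * T)) := by
  have := hF.isProbabilityMeasure
  have hpos : ∀ y ∈ posOrthant N, 0 < G y := fun y hy => generator_pos hN hG hMEV hy
  have hsurplus {η : ℝ} (hη : 0 < η) : socialSurplus F η = logGenerator G η :=
    funext fun θ => socialSurplus_eq_log hF hN hG hMEV hη θ
  have hzero (η : ℝ) : logGenerator G η 0 = η * Real.log (G 1) := by
    simp only [logGenerator, Pi.zero_apply, zero_div, Real.exp_zero]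
    rfl
  have hmain (η : ℝ) (hη : 0 < η) : Differentiable ℝ (socialSurplus F η) ∧
      (∀ t ∈ Finset.Icc 1 T, ssaChoice F η u t ∈ stdSimplex ℝ (Fin N)) ∧
      regret u (ssaChoice F η u) T
        ≤ η * Real.log (G 1) + (2 * M + 1) / (2 * η) * T * umax ^ 2 := by
    refine ⟨hsurplus hη ▸ differentiable_logGenerator hG hpos, fun t _ => ?_, ?_⟩
    · unfold ssaChoice
      rw [hsurplus hη]
      exact fderiv_logGenerator_mem_stdSimplex hG hpos hη _
    · rw [← hzero, ← hsurplus hη]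
      exact regret_le_of_potential hN (by positivity) (fun θ i => le_socialSurplus hF η θ i)
        (fun θ v => by
          rw [hsurplus hη]
          exact logGenerator_add_le hG hpos hη hGM θ v) u T hu
  refine ⟨hmain, fun hN2 humax η hη => ?_⟩
  -- log G(1) is the surplus at zero payoffs with η = 1.
  have hlog : 0 < Real.log (G 1) := by
    have h := socialSurplus_zero_pos hF hN2 one_pos
    rwa [hsurplus one_pos, hzero, one_mul] at h
  have hT' : (0 : ℝ) < T := by exact_mod_cast hT
  have hη0 : 0 < η := by
    rw [hη]
    positivity
  refine ⟨hη0, (hmain η hη0).2.2.trans (le_of_eq ?_)⟩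
  have hsq : η ^ 2 * (2 * Real.log (G 1)) = (2 * M + 1) * T * umax ^ 2 := by
    rw [hη, Real.sq_sqrt (by positivity)]
    field_simp
  -- The chosen η balances the two terms of the bound, each equal to η log G(1).
  have hroot : umax * √(2 * Real.log (G 1) * (2 * M + 1) * T) = 2 * Real.log (G 1) * η := by
    rw [← Real.sqrt_sq humax.le, ← Real.sqrt_mul (sq_nonneg _),
      Real.sqrt_eq_iff_mul_self_eq (by positivity) (by positivity)]
    linear_combination -(2 * Real.log (G 1)) * hsq
  have h1 : (2 * M + 1) / (2 * η) * T * umax ^ 2 = ((2 * M + 1) * T * umax ^ 2) / (2 * η) := by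
    ring
  rw [hroot, h1, ← hsq]
  field_simp
  ring
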